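/- Let $\mathbb{F}$ be a field. Suppose Lie algebras $M$ and $N$ over $\mathbb{F}$ act on each other by derivations, ${}^{m}n\in N$ and ${}^{n}m\in M$, compatibly, i.e. ${}^{({}^{m}n)}m'=[m',{}^{n}m]$ and ${}^{({}^{n}m)}n'=[n',{}^{m}n]$. Their non-abelian tensor product $M\otimes N$ is the Lie algebra over $\mathbb{F}$ generated by the symbols $m\otimes n$ ($m\in M$, $n\in N$) subject to the relations $$c(m\otimes n)=cm\otimes n=m\otimes cn,\quad (m+m')\otimes n=m\otimes n+m'\otimes n,\quad m\otimes(n+n')=m\otimes n+m\otimes n',$$ $$[m,m']\otimes n=m\otimes{}^{m'}n-m'\otimes{}^{m}n,\quad m\otimes[n,n']={}^{n'}m\otimes n-{}^{n}m\otimes n',\quad [m\otimes n,m'\otimes n']=-\,{}^{n}m\otimes{}^{m'}n'$$ for $c\in\mathbb{F}$, $m,m'\in M$, $n,n'\in N$. For a Lie algebra $L$ over $\mathbb{F}$, let $L\otimes L$ be formed with respect to the actions of $L$ on itself by ${}^{x}y=[x,y]$. Then $L$ acts on $L\otimes L$ by ${}^{x}(a\otimes b)=[x,a]\otimes b+a\otimes[x,b]$,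 and $L\otimes L$ acts on $L$ by ${}^{t}x=[\lambda(t),x]$, where $\lambda:L\otimes L\to L$ is the homomorphism with $\lambda(a\otimes b)=[a,b]$. These actions are compatible; let $\otimes^{3}L=(L\otimes L)\otimes L$ be the corresponding non-abelian tensor product. **Theorem.** Let $L$ be a non-abelian nilpotent Lie algebra over $\mathbb{F}$ of finite dimension $n$, and let $m=\dim L^{2}$, where $L^{2}=[L,L]$. Then $\otimes^{3}L$ is finite-dimensional and $$\dim\otimes^{3}L\le n(n-m)^{2}.$$ Moreover, if $m=1$, then equality holds if and only if $L\cong H(1)$, where $H(1)$ is the $3$-dimensional Heisenberg Lie algebra over $\mathbb{F}$, with basis $x,y,z$, $[x,y]=z$ and $z$ central. -/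

import Mathlib

universe u v w

noncomputable section

/-! ## Compatible actions and the non-abelian tensor product of Lie algebras -/

/-- Mutual actions of two Lie algebras `L` and `K` on each other, by derivations, which are
compatible: `^(^l k) l' = [l', ^k l]` and `^(^k l) k' = [k', ^l k]`. -/
structure CompatibleLieActions (F : Type u) (L : Type v) (K : Type w) [Field F]
    [LieRing L] [LieAlgebra F L] [LieRing K] [LieAlgebra F K] where
  /-- The action of `L` on `K`. -/
  actL : L →ₗ⁅F⁆ LieDerivation F K K
  /-- The action of `K` on `L`. -/
  actK : K →ₗ⁅F⁆ LieDerivation F L L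
  compatL : ∀ (l l' : L) (k : K), actK (actL l k) l' = ⁅l', actK k l⁆
  compatK : ∀ (k k' : K) (l : L), actL (actK k l) k' = ⁅k', actL l k⁆

section Tensor

variable {F : Type u} {L : Type v} {K : Type w} [Field F]
  [LieRing L] [LieAlgebra F L] [LieRing K] [LieAlgebra F K]

/-- The symbol `l ⊗ k` in the free Lie algebra on the set `L × K`. -/
abbrev tensorSymbol (F : Type u) {L : Type v} {K : Type w} [Field F] (l : L) (k : K) :
    FreeLieAlgebra F (L × K) :=
  FreeLieAlgebra.of F (l, k)

/-- The defining relators (each to be set equal to zero) of the non-abelian tensor product. -/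
inductive TensorRelator (A : CompatibleLieActions F L K) : FreeLieAlgebra F (L × K) → Prop
  | smul_left (c : F) (l : L) (k : K) :
      TensorRelator A (c • tensorSymbol F l k - tensorSymbol F (c • l) k)
  | smul_right (c : F) (l : L) (k : K) :
      TensorRelator A (c • tensorSymbol F l k - tensorSymbol F l (c • k))
  | add_left (l l' : L) (k : K) :
      TensorRelator A (tensorSymbol F (l + l') k - (tensorSymbol F l k + tensorSymbol F l' k))
  | add_right (l : L) (k k' : K) :
      TensorRelator A (tensorSymbol F l (k + k') - (tensorSymbol F l k + tensorSymbol F l k'))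
  | lie_left (l l' : L) (k : K) :
      TensorRelator A (tensorSymbol F ⁅l, l'⁆ k -
        (tensorSymbol F l (A.actL l' k) - tensorSymbol F l' (A.actL l k)))
  | lie_right (l : L) (k k' : K) :
      TensorRelator A (tensorSymbol F l ⁅k, k'⁆ -
        (tensorSymbol F (A.actK k' l) k - tensorSymbol F (A.actK k l) k'))
  | lie_lie (l l' : L) (k k' : K) :
      TensorRelator A (⁅tensorSymbol F l k, tensorSymbol F l' k'⁆ -
        -(tensorSymbol F (A.actK k l) (A.actL l' k')))

/-- The non-abelian tensor product `L ⊗ K`: the Lie algebra generated by the symbols `l ⊗ k`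
subject to the defining relations. -/
def LieTensor (A : CompatibleLieActions F L K) : Type (max u v w) :=
  FreeLieAlgebra F (L × K) ⧸
    LieSubmodule.lieSpan F (FreeLieAlgebra F (L × K)) {a | TensorRelator A a}

namespace LieTensor

variable (A : CompatibleLieActions F L K)

instance : LieRing (LieTensor A) :=
  inferInstanceAs (LieRing (FreeLieAlgebra F (L × K) ⧸
    LieSubmodule.lieSpan F (FreeLieAlgebra F (L × K)) {a | TensorRelator A a}))

instance : LieAlgebra F (LieTensor A) :=
  inferInstanceAs (LieAlgebra F (FreeLieAlgebra F (L × K) ⧸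
    LieSubmodule.lieSpan F (FreeLieAlgebra F (L × K)) {a | TensorRelator A a}))

/-- The quotient map from the free Lie algebra. -/
def mk : FreeLieAlgebra F (L × K) →ₗ⁅F⁆ LieTensor A where
  toFun a := LieSubmodule.Quotient.mk a
  map_add' _ _ := rfl
  map_smul' _ _ := rfl
  map_lie' := rfl

/-- The generator `l ⊗ k` of `L ⊗ K`. -/
def tmul (l : L) (k : K) : LieTensor A := mk A (tensorSymbol F l k)

theorem mk_surjective : Function.Surjective (mk A) := Quot.mk_surjective

theorem mk_eq_zero {a : FreeLieAlgebra F (L × K)} (h : TensorRelator A a) : mk A a = 0 :=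
  (LieSubmodule.Quotient.mk_eq_zero' (N := LieSubmodule.lieSpan F (FreeLieAlgebra F (L × K))
    {a | TensorRelator A a})).2 (LieSubmodule.subset_lieSpan h)

theorem smul_tmul_left (c : F) (l : L) (k : K) : tmul A (c • l) k = c • tmul A l k := by
  have h := mk_eq_zero A (.smul_left c l k)
  rw [map_sub, map_smul, sub_eq_zero] at h
  exact h.symm

theorem smul_tmul_right (c : F) (l : L) (k : K) : tmul A l (c • k) = c • tmul A l k := by
  have h := mk_eq_zero A (.smul_right c l k)
  rw [map_sub, map_smul, sub_eq_zero] at h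
  exact h.symm

theorem add_tmul (l l' : L) (k : K) : tmul A (l + l') k = tmul A l k + tmul A l' k := by
  have h := mk_eq_zero A (.add_left l l' k)
  rwa [map_sub, map_add, sub_eq_zero] at h

theorem tmul_add (l : L) (k k' : K) : tmul A l (k + k') = tmul A l k + tmul A l k' := by
  have h := mk_eq_zero A (.add_right l k k')
  rwa [map_sub, map_add, sub_eq_zero] at h

theorem lie_tmul (l l' : L) (k : K) :
    tmul A ⁅l, l'⁆ k = tmul A l (A.actL l' k) - tmul A l' (A.actL l k) := by
  have h := mk_eq_zero A (.lie_left l l' k)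
  rwa [map_sub, map_sub, sub_eq_zero] at h

theorem tmul_lie (l : L) (k k' : K) :
    tmul A l ⁅k, k'⁆ = tmul A (A.actK k' l) k - tmul A (A.actK k l) k' := by
  have h := mk_eq_zero A (.lie_right l k k')
  rwa [map_sub, map_sub, sub_eq_zero] at h

theorem tmul_lie_tmul (l l' : L) (k k' : K) :
    ⁅tmul A l k, tmul A l' k'⁆ = -tmul A (A.actK k l) (A.actL l' k') := by
  have h := mk_eq_zero A (.lie_lie l l' k k')
  rwa [map_sub, LieHom.map_lie, map_neg, sub_eq_zero] at h

variable {A} {Q : Type*} [LieRing Q] [LieAlgebra F Q]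

/-- A homomorphism out of the free Lie algebra that kills the relators descends to `L ⊗ K`. -/
def desc (f : FreeLieAlgebra F (L × K) →ₗ⁅F⁆ Q) (hf : ∀ a, TensorRelator A a → f a = 0) :
    LieTensor A →ₗ⁅F⁆ Q :=
  have hle : (LieSubmodule.lieSpan F (FreeLieAlgebra F (L × K))
      {a | TensorRelator A a}).toSubmodule ≤ LinearMap.ker (f : FreeLieAlgebra F (L × K) →ₗ[F] Q) :=
    (LieSubmodule.lieSpan_le (N := f.ker)).2 fun a ha => f.mem_ker.2 (hf a ha)
  { toFun := Submodule.liftQ _ (f : FreeLieAlgebra F (L × K) →ₗ[F] Q) hle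
    map_add' := fun x y => map_add (Submodule.liftQ _ _ hle) x y
    map_smul' := fun c x => map_smul (Submodule.liftQ _ _ hle) c x
    map_lie' := by
      intro x y
      obtain ⟨x, rfl⟩ := mk_surjective A x
      obtain ⟨y, rfl⟩ := mk_surjective A y
      exact f.map_lie x y }

theorem desc_tmul (f : FreeLieAlgebra F (L × K) →ₗ⁅F⁆ Q)
    (hf : ∀ a, TensorRelator A a → f a = 0) (l : L) (k : K) :
    desc f hf (tmul A l k) = f (tensorSymbol F l k) := rfl

theorem hom_ext {f g : LieTensor A →ₗ⁅F⁆ Q} (h : ∀ l k, f (tmul A l k) = g (tmul A l k)) :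
    f = g := by
  have h1 : f.comp (mk A) = g.comp (mk A) := FreeLieAlgebra.hom_ext fun x => h x.1 x.2
  ext x
  obtain ⟨x, rfl⟩ := mk_surjective A x
  exact LieHom.congr_fun h1 x

end LieTensor

end Tensor

/-! ## Derivations as homomorphisms to the Lie algebra `T ⊕ εT`, with `ε² = 0` -/

/-- The Lie algebra `T ⊕ εT`, with `ε² = 0`. -/
@[ext] structure LieDual (T : Type u) where
  re : T
  eps : T

namespace LieDual

variable {F : Type u} {T : Type v} [Field F] [LieRing T] [LieAlgebra F T]

/-- As a raw type, `T ⊕ εT` is the product `T × T`. -/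
def toProd : LieDual T ≃ T × T where
  toFun x := (x.re, x.eps)
  invFun x := ⟨x.1, x.2⟩
  left_inv _ := rfl
  right_inv _ := rfl

instance : AddCommGroup (LieDual T) := toProd.addCommGroup

instance : Module F (LieDual T) := toProd.module F

instance : Bracket (LieDual T) (LieDual T) where
  bracket x y := ⟨⁅x.re, y.re⁆, ⁅x.re, y.eps⁆ + ⁅x.eps, y.re⁆⟩

theorem zero_def : (0 : LieDual T) = ⟨0, 0⟩ := rfl
theorem add_def (x y : LieDual T) : x + y = ⟨x.re + y.re, x.eps + y.eps⟩ := rfl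
theorem sub_def (x y : LieDual T) : x - y = ⟨x.re - y.re, x.eps - y.eps⟩ := rfl
theorem neg_def (x : LieDual T) : -x = ⟨-x.re, -x.eps⟩ := rfl
theorem smul_def (c : F) (x : LieDual T) : c • x = ⟨c • x.re, c • x.eps⟩ := rfl
theorem lie_def (x y : LieDual T) :
    ⁅x, y⁆ = ⟨⁅x.re, y.re⁆, ⁅x.re, y.eps⁆ + ⁅x.eps, y.re⁆⟩ := rfl

instance : LieRing (LieDual T) where
  add_lie x y z := by
    simp only [add_def, lie_def, add_lie, LieDual.mk.injEq, true_and]; abel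
  lie_add x y z := by
    simp only [add_def, lie_def, lie_add, LieDual.mk.injEq, true_and]; abel
  lie_self x := by
    simp only [lie_def, zero_def, lie_self, LieDual.mk.injEq, true_and]
    rw [← lie_skew x.re x.eps]; abel
  leibniz_lie x y z := by
    simp only [add_def, lie_def, add_lie, lie_add, LieDual.mk.injEq]
    refine ⟨leibniz_lie _ _ _, ?_⟩
    rw [leibniz_lie x.re y.re z.eps, leibniz_lie x.re y.eps z.re, leibniz_lie x.eps y.re z.re]
    abel

instance : LieAlgebra F (LieDual T) where
  lie_smul c x y := by
    simp only [smul_def, lie_def, lie_smul, smul_add]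

/-- The projection onto the first component. -/
def reHom (F : Type u) (T : Type v) [Field F] [LieRing T] [LieAlgebra F T] :
    LieDual T →ₗ⁅F⁆ T where
  toFun x := x.re
  map_add' _ _ := rfl
  map_smul' _ _ := rfl
  map_lie' := rfl

/-- The homomorphism `t ↦ t + ε D(t)` attached to a derivation `D`. -/
def ofDerivation (D : LieDerivation F T T) : T →ₗ⁅F⁆ LieDual T where
  toFun t := ⟨t, D t⟩
  map_add' x y := by simp [add_def]
  map_smul' c x := by simp [smul_def]
  map_lie' := by
    intro x y
    simp only [lie_def, LieDerivation.apply_lie_eq_add]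

/-- A homomorphism `T → T ⊕ εT` which is a section of the projection is of the form
`t ↦ t + ε D(t)` with `D` a derivation. -/
def toDerivation (f : T →ₗ⁅F⁆ LieDual T) (hf : ∀ t, (f t).re = t) : LieDerivation F T T where
  toFun t := (f t).eps
  map_add' x y := by rw [map_add]; rfl
  map_smul' c x := by rw [map_smul]; rfl
  leibniz' x y := by
    change (f ⁅x, y⁆).eps = ⁅x, (f y).eps⁆ - ⁅y, (f x).eps⁆
    rw [LieHom.map_lie, lie_def, hf, hf, ← lie_skew y, sub_neg_eq_add]

end LieDual

/-! ## The tensor square and the triple tensor product -/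

section Square

variable (F : Type u) (L : Type v) [Field F] [LieRing L] [LieAlgebra F L]

variable {F L} in
theorem lieAd_apply (x y : L) : LieDerivation.ad F L x y = ⁅x, y⁆ := by
  have h : (LieDerivation.ad F L x : L →ₗ[F] L) y = LieAlgebra.ad F L x y := by
    rw [LieDerivation.coe_ad_apply_eq_ad_apply]
  exact h

/-- The actions of `L` on itself by Lie multiplication. -/
def selfActions : CompatibleLieActions F L L where
  actL := LieDerivation.ad F L
  actK := LieDerivation.ad F L
  compatL l l' k := by
    simp only [lieAd_apply]
    rw [← lie_skew k l, lie_neg, lie_skew]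
  compatK k k' l := by
    simp only [lieAd_apply]
    rw [← lie_skew l k, lie_neg, lie_skew]

/-- The non-abelian tensor square `L ⊗ L`. -/
abbrev LieTensorSquare : Type (max u v) := LieTensor (selfActions F L)

namespace LieTensorSquare

open LieTensor

variable {L}

/-- The generator `a ⊗ b` of the tensor square. -/
abbrev tm (a b : L) : LieTensorSquare F L := tmul (selfActions F L) a b

variable {F}

theorem actL_apply (x y : L) : (selfActions F L).actL x y = ⁅x, y⁆ := lieAd_apply x y
theorem actK_apply (x y : L) : (selfActions F L).actK x y = ⁅x, y⁆ := lieAd_apply x y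

variable (F)

theorem lie_tm (a b c : L) : tm F ⁅a, b⁆ c = tm F a ⁅b, c⁆ - tm F b ⁅a, c⁆ :=
  by simpa only [actL_apply] using lie_tmul (selfActions F L) a b c

theorem tm_lie (a b c : L) : tm F a ⁅b, c⁆ = tm F ⁅c, a⁆ b - tm F ⁅b, a⁆ c :=
  by simpa only [actK_apply] using tmul_lie (selfActions F L) a b c

theorem tm_add (a b c : L) : tm F a (b + c) = tm F a b + tm F a c := tmul_add _ a b c
theorem add_tm (a b c : L) : tm F (a + b) c = tm F a c + tm F b c := add_tmul _ a b c

theorem tm_neg (a b : L) : tm F a (-b) = -tm F a b := by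
  have h := smul_tmul_right (selfActions F L) (-1) a b
  rwa [neg_one_smul, neg_one_smul] at h

theorem neg_tm (a b : L) : tm F (-a) b = -tm F a b := by
  have h := smul_tmul_left (selfActions F L) (-1) a b
  rwa [neg_one_smul, neg_one_smul] at h

theorem tm_lie_tm (a b c d : L) : ⁅tm F a b, tm F c d⁆ = tm F ⁅a, b⁆ ⁅c, d⁆ := by
  have h : ⁅tm F a b, tm F c d⁆ = -tm F ⁅b, a⁆ ⁅c, d⁆ := by
    simpa only [actK_apply, actL_apply] using tmul_lie_tmul (selfActions F L) a c b d
  rw [h, ← lie_skew a b, neg_tm]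

theorem lie_tm_skew (a b c : L) : tm F ⁅a, b⁆ c = -tm F c ⁅a, b⁆ := by
  have h1 := lie_tm F a b c
  have h2 := lie_tm F b c a
  have h3 := lie_tm F c a b
  have k1 := tm_lie F a b c
  have k2 := tm_lie F b c a
  have k3 := tm_lie F c a b
  have e1 : ⁅a, c⁆ = -⁅c, a⁆ := (lie_skew a c).symm
  have e2 : ⁅b, a⁆ = -⁅a, b⁆ := (lie_skew b a).symm
  have e3 : ⁅c, b⁆ = -⁅b, c⁆ := (lie_skew c b).symm
  rw [e1, tm_neg] at h1
  rw [e2, neg_tm] at k1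
  rw [e3, neg_tm] at k2
  rw [e1, neg_tm] at k3
  rw [k1, k2] at h1
  rw [k3]
  have h4 : tm F ⁅a, b⁆ c + tm F ⁅b, c⁆ a + tm F ⁅c, a⁆ b = 0 := by
    have := sub_eq_zero.2 h1
    rw [← neg_eq_zero, ← this]; abel
  rw [← sub_eq_zero, ← h4]; abel

/-- The homomorphism `λ : L ⊗ L → L`, `a ⊗ b ↦ [a, b]`. -/
def commutatorHom : LieTensorSquare F L →ₗ⁅F⁆ L :=
  desc (FreeLieAlgebra.lift F fun x : L × L => ⁅x.1, x.2⁆) (by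
    intro a ha
    cases ha with
    | smul_left c l k => simp
    | smul_right c l k => simp
    | add_left l l' k => simp
    | add_right l k k' => simp
    | lie_left l l' k =>
      simp only [map_sub, FreeLieAlgebra.lift_of_apply, actL_apply]
      rw [leibniz_lie l l' k]; abel
    | lie_right l k k' =>
      simp only [map_sub, FreeLieAlgebra.lift_of_apply, actK_apply]
      rw [leibniz_lie l k k', ← lie_skew k l, ← lie_skew k' l, neg_lie, neg_lie,
        ← lie_skew k ⁅l, k'⁆]
      abel
    | lie_lie l l' k k' =>
      simp only [map_sub, map_neg, LieHom.map_lie, FreeLieAlgebra.lift_of_apply, actK_apply,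
        actL_apply]
      rw [← lie_skew k l, neg_lie]; abel)

theorem commutatorHom_tm (a b : L) : commutatorHom F (tm F a b) = ⁅a, b⁆ :=
  (desc_tmul _ _ a b).trans (FreeLieAlgebra.lift_of_apply _ _)

/-- The homomorphism `l ⊗ k ↦ l ⊗ k + ε ([x, l] ⊗ k + l ⊗ [x, k])`. -/
def actionAux (x : L) : LieTensorSquare F L →ₗ⁅F⁆ LieDual (LieTensorSquare F L) :=
  desc (FreeLieAlgebra.lift F fun p : L × L =>
    (⟨tm F p.1 p.2, tm F ⁅x, p.1⁆ p.2 + tm F p.1 ⁅x, p.2⁆⟩ : LieDual (LieTensorSquare F L))) (by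
    intro a ha
    cases ha with
    | smul_left c l k =>
      simp [LieDual.smul_def, LieDual.zero_def, smul_tmul_left]
    | smul_right c l k =>
      simp [LieDual.smul_def, LieDual.zero_def, smul_tmul_right]
    | add_left l l' k =>
      simp only [map_sub, map_add, FreeLieAlgebra.lift_of_apply, lie_add, add_tm, LieDual.sub_def,
        LieDual.add_def, LieDual.zero_def, LieDual.mk.injEq]
      constructor <;> abel
    | add_right l k k' =>
      simp only [map_sub, map_add, FreeLieAlgebra.lift_of_apply, lie_add, tm_add, LieDual.sub_def,
        LieDual.add_def, LieDual.zero_def, LieDual.mk.injEq]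
      constructor <;> abel
    | lie_left l l' k =>
      simp only [map_sub, FreeLieAlgebra.lift_of_apply, actL_apply, LieDual.sub_def,
        LieDual.zero_def, LieDual.mk.injEq]
      refine ⟨sub_eq_zero.2 (lie_tm F l l' k), ?_⟩
      rw [leibniz_lie x l l', add_tm, lie_tm F ⁅x, l⁆ l' k, lie_tm F l ⁅x, l'⁆ k,
        lie_tm F l l' ⁅x, k⁆, leibniz_lie x l' k, leibniz_lie x l k, tm_add, tm_add]
      abel
    | lie_right l k k' =>
      simp only [map_sub, FreeLieAlgebra.lift_of_apply, actK_apply, LieDual.sub_def,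
        LieDual.zero_def, LieDual.mk.injEq]
      refine ⟨sub_eq_zero.2 (tm_lie F l k k'), ?_⟩
      rw [leibniz_lie x k k', tm_add, tm_lie F ⁅x, l⁆ k k', tm_lie F l ⁅x, k⁆ k',
        tm_lie F l k ⁅x, k'⁆, leibniz_lie x k' l, leibniz_lie x k l, add_tm, add_tm]
      abel
    | lie_lie l l' k k' =>
      simp only [map_sub, map_neg, LieHom.map_lie, FreeLieAlgebra.lift_of_apply, actK_apply,
        actL_apply, LieDual.sub_def, LieDual.neg_def, LieDual.lie_def, LieDual.zero_def,
        LieDual.mk.injEq, lie_add, add_lie, tm_lie_tm]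
      rw [← lie_skew k l, lie_neg, neg_tm, neg_tm, neg_tm, leibniz_lie x l k, leibniz_lie x l' k',
        tm_add, add_tm]
      constructor <;> abel)

theorem actionAux_tm (x a b : L) :
    actionAux F x (tm F a b) = ⟨tm F a b, tm F ⁅x, a⁆ b + tm F a ⁅x, b⁆⟩ :=
  (desc_tmul _ _ a b).trans (FreeLieAlgebra.lift_of_apply _ _)

/-- The derivation of `L ⊗ L` by which `x : L` acts. -/
def actionDer (x : L) : LieDerivation F (LieTensorSquare F L) (LieTensorSquare F L) :=
  LieDual.toDerivation (actionAux F x) (by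
    have h : (LieDual.reHom F _).comp (actionAux F x) = LieHom.id :=
      hom_ext fun a b => by
        rw [LieHom.comp_apply, actionAux_tm]; rfl
    exact fun t => LieHom.congr_fun h t)

theorem actionDer_tm (x a b : L) :
    actionDer F x (tm F a b) = tm F ⁅x, a⁆ b + tm F a ⁅x, b⁆ := by
  change (actionAux F x (tm F a b)).eps = _
  rw [actionAux_tm]

variable {F} in
theorem derivation_ext {D E : LieDerivation F (LieTensorSquare F L) (LieTensorSquare F L)}
    (h : ∀ a b, D (tm F a b) = E (tm F a b)) : D = E := by
  have h1 : LieDual.ofDerivation D = LieDual.ofDerivation E :=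
    hom_ext fun a b => LieDual.ext rfl (h a b)
  ext t
  exact congrArg LieDual.eps (LieHom.congr_fun h1 t)

/-- The action of `L` on `L ⊗ L`, `^x (a ⊗ b) = [x, a] ⊗ b + a ⊗ [x, b]`. -/
def action : L →ₗ⁅F⁆ LieDerivation F (LieTensorSquare F L) (LieTensorSquare F L) where
  toFun := actionDer F
  map_add' x y := derivation_ext fun a b => by
    rw [LieDerivation.add_apply]
    simp only [actionDer_tm, add_lie, add_tm, tm_add]
    abel
  map_smul' c x := derivation_ext fun a b => by
    rw [RingHom.id_apply, LieDerivation.smul_apply]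
    simp only [actionDer_tm, smul_lie, smul_tmul_left, smul_tmul_right, smul_add]
  map_lie' := by
    intro x y
    refine derivation_ext fun a b => ?_
    rw [LieDerivation.lie_apply]
    simp only [actionDer_tm, map_add, lie_lie, sub_eq_add_neg, tm_add, add_tm, tm_neg, neg_tm]
    abel

theorem action_tm (x a b : L) : action F x (tm F a b) = tm F ⁅x, a⁆ b + tm F a ⁅x, b⁆ :=
  actionDer_tm F x a b

theorem commutatorHom_action (x : L) (t : LieTensorSquare F L) :
    commutatorHom F (action F x t) = ⁅x, commutatorHom F t⁆ := by
  have h : (⟨commutatorHom F t, commutatorHom F (action F x t)⟩ : LieDual L) =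
      ⟨commutatorHom F t, ⁅x, commutatorHom F t⁆⟩ := by
    let f : LieDual (LieTensorSquare F L) →ₗ⁅F⁆ LieDual L :=
      { toFun := fun s => ⟨commutatorHom F s.re, commutatorHom F s.eps⟩
        map_add' := fun s s' => by simp [LieDual.add_def]
        map_smul' := fun c s => by simp [LieDual.smul_def]
        map_lie' := by intro s s'; simp [LieDual.lie_def] }
    have hD (t) : ((LieDual.ofDerivation (LieDerivation.ad F L x)).comp (commutatorHom F)) t =
        ⟨commutatorHom F t, ⁅x, commutatorHom F t⁆⟩ :=
      LieDual.ext rfl (lieAd_apply _ _)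
    have h1 : f.comp (LieDual.ofDerivation (action F x)) =
        (LieDual.ofDerivation (LieDerivation.ad F L x)).comp (commutatorHom F) :=
      hom_ext fun a b => by
        rw [hD]
        change (⟨commutatorHom F (tm F a b), commutatorHom F (action F x (tm F a b))⟩ : LieDual L)
          = ⟨commutatorHom F (tm F a b), ⁅x, commutatorHom F (tm F a b)⁆⟩
        rw [action_tm, map_add, commutatorHom_tm, commutatorHom_tm, commutatorHom_tm,
          leibniz_lie x a b]
    exact (LieHom.congr_fun h1 t).trans (hD t)
  exact congrArg LieDual.eps h

theorem action_commutatorHom (s t : LieTensorSquare F L) :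
    action F (commutatorHom F s) t = ⁅s, t⁆ := by
  have h : (action F).comp (commutatorHom F) = LieDerivation.ad F (LieTensorSquare F L) :=
    hom_ext fun a b => derivation_ext fun c d => by
      rw [lieAd_apply, LieHom.comp_apply, commutatorHom_tm, action_tm, tm_lie_tm, tm_lie F ⁅a, b⁆ c d,
        ← lie_skew c ⁅a, b⁆, ← lie_skew d ⁅a, b⁆, neg_tm, neg_tm,
        lie_tm_skew F ⁅a, b⁆ d c]
      abel
  exact (LieDerivation.congr_fun (LieHom.congr_fun h s) t).trans (lieAd_apply s t)

end LieTensorSquare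

open LieTensorSquare in
/-- The mutual actions of `L ⊗ L` and `L`: `L ⊗ L` acts on `L` by `^t l = [λ(t), l]`, and `L` acts
on `L ⊗ L` by `^x (a ⊗ b) = [x, a] ⊗ b + a ⊗ [x, b]`. -/
def tripleActions : CompatibleLieActions F (LieTensorSquare F L) L where
  actL := (LieDerivation.ad F L).comp (commutatorHom F)
  actK := action F
  compatL t t' x := by
    rw [LieHom.comp_apply, lieAd_apply]
    rw [← lie_skew, ← commutatorHom_action, map_neg, LieDerivation.neg_apply,
      action_commutatorHom, lie_skew]
  compatK x x' t := by
    rw [LieHom.comp_apply, LieHom.comp_apply, lieAd_apply, lieAd_apply]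
    rw [commutatorHom_action, ← lie_skew x, neg_lie, lie_skew]

/-- The triple tensor product `⊗³ L = (L ⊗ L) ⊗ L`. -/
abbrev LieTensorTriple : Type (max u v) := LieTensor (tripleActions F L)

end Square

/-! ## The Heisenberg Lie algebras -/

/-- The Heisenberg Lie algebra `H(m)`, of dimension `2m + 1`: an element
`∑ aᵢ xᵢ + ∑ bᵢ yᵢ + c z` is stored as its coordinates, and the only nonzero brackets of basis
elements are `[xᵢ, yᵢ] = z = -[yᵢ, xᵢ]`. -/
@[ext] structure HeisenbergLie (F : Type u) (m : ℕ) where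
  x : Fin m → F
  y : Fin m → F
  z : F

namespace HeisenbergLie

variable {F : Type u} [Field F] {m : ℕ}

/-- As a raw type, `H(m)` is `F^m × F^m × F`. -/
def toProd : HeisenbergLie F m ≃ (Fin m → F) × (Fin m → F) × F where
  toFun a := (a.x, a.y, a.z)
  invFun a := ⟨a.1, a.2.1, a.2.2⟩
  left_inv _ := rfl
  right_inv _ := rfl

instance : AddCommGroup (HeisenbergLie F m) := toProd.addCommGroup

instance : Module F (HeisenbergLie F m) := toProd.module F

instance : Bracket (HeisenbergLie F m) (HeisenbergLie F m) where
  bracket a b := ⟨0, 0, ∑ i, (a.x i * b.y i - a.y i * b.x i)⟩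

theorem zero_def : (0 : HeisenbergLie F m) = ⟨0, 0, 0⟩ := rfl
theorem add_def (a b : HeisenbergLie F m) : a + b = ⟨a.x + b.x, a.y + b.y, a.z + b.z⟩ := rfl
theorem smul_def (c : F) (a : HeisenbergLie F m) : c • a = ⟨c • a.x, c • a.y, c • a.z⟩ := rfl
theorem lie_def (a b : HeisenbergLie F m) :
    ⁅a, b⁆ = ⟨0, 0, ∑ i, (a.x i * b.y i - a.y i * b.x i)⟩ := rfl

instance : LieRing (HeisenbergLie F m) where
  add_lie a b c := by
    simp only [add_def, lie_def, Pi.add_apply, add_zero, ← Finset.sum_add_distrib,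
      HeisenbergLie.mk.injEq, true_and]
    exact Finset.sum_congr rfl fun i _ => by ring
  lie_add a b c := by
    simp only [add_def, lie_def, Pi.add_apply, add_zero, ← Finset.sum_add_distrib,
      HeisenbergLie.mk.injEq, true_and]
    exact Finset.sum_congr rfl fun i _ => by ring
  lie_self a := by
    simp only [lie_def, zero_def, HeisenbergLie.mk.injEq, true_and]
    exact Finset.sum_eq_zero fun i _ => by ring
  leibniz_lie a b c := by
    simp [add_def, lie_def]

instance : LieAlgebra F (HeisenbergLie F m) where
  lie_smul c a b := by
    simp only [smul_def, lie_def, Pi.smul_apply, smul_eq_mul, smul_zero, Finset.mul_sum,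
      HeisenbergLie.mk.injEq, true_and]
    exact Finset.sum_congr rfl fun i _ => by ring

end HeisenbergLie

end

/-!
The bound comes from one observation, applied twice. In `L ⊗ K` the bracket of two symbols is again
a symbol up to sign, so the symbols span `L ⊗ K` linearly (`LieTensor.span_tmul_eq_top`), and
`l ⊗ [k, k'] = ^{k'}l ⊗ k - ^k l ⊗ k'` reduces the second factor to any set of Lie algebra
generators of `K`. Hence `dim (L ⊗ K) ≤ d · dim L` when `K` has `d` generators
(`LieTensor.finrank_le_of_lieSpan`). A nilpotent `L` is generated by `d = n - m` elements, lifted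
from a basis of `L / L²` (`exists_lieSpan_eq_top`), so that `dim (L ⊗ L) ≤ n d` and
`dim ⊗³ L ≤ d · dim (L ⊗ L) ≤ n d²`.

Let `m = 1`. Then `L²` is central, spanned by some `z = [a, b]`, and `a, b, z` span a copy of
`H(1)` in `L` (`exists_injective_heisenberg`); so `n ≥ 3`, and `n = 3` forces `L ≅ H(1)`. If
`n ≥ 4`, there are at least three generators `sᵢ`. As `z ⊗ u = a ⊗ [b, u] - b ⊗ [a, u]`, all
`z ⊗ sᵢ` lie in the span of `a ⊗ z` and `b ⊗ z`, which is a linear relation among the `n d` spanning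
symbols of `L ⊗ L` (`LieTensorSquare.finrank_lt_of_derived_line`), and the bound is strict.

For `L = H(1)` the bound is 12. It is attained because explicit coordinates on `L ⊗ L`, which has
dimension 6, and then on `⊗³ L`, respect all relations and map `⊗³ L` onto a 12-dimensional space
(`twelve_le_finrank_lieTensorTriple`).
-/

open Module

noncomputable section

/-! ### Spanning sets of a non-abelian tensor product -/

namespace LieTensor

variable {F : Type u} {L : Type v} {K : Type w} [Field F]
  [LieRing L] [LieAlgebra F L] [LieRing K] [LieAlgebra F K] (A : CompatibleLieActions F L K)

/-- The symbol `l ⊗ k` as a bilinear map. -/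
def tmulBilin : L →ₗ[F] K →ₗ[F] LieTensor A :=
  LinearMap.mk₂ F (tmul A) (add_tmul A) (smul_tmul_left A) (tmul_add A) (smul_tmul_right A)

theorem tmulBilin_apply (l : L) (k : K) : tmulBilin A l k = tmul A l k := rfl

/-- The bracket of two generators is, up to sign, again a generator, so that the generators
already span `L ⊗ K` as a vector space. -/
theorem span_tmul_eq_top :
    Submodule.span F (Set.range fun p : L × K => tmul A p.1 p.2) = ⊤ := by
  let S : LieSubalgebra F (LieTensor A) :=
    { Submodule.span F (Set.range fun p : L × K => tmul A p.1 p.2) with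
      lie_mem' := by
        intro s t hs ht
        change s ∈ Submodule.span F _ at hs
        change t ∈ Submodule.span F _ at ht
        change ⁅s, t⁆ ∈ Submodule.span F _
        induction hs using Submodule.span_induction with
        | zero => rw [zero_lie]; exact Submodule.zero_mem _
        | add s s' _ _ h h' => rw [add_lie]; exact Submodule.add_mem _ h h'
        | smul c s _ h => rw [smul_lie]; exact Submodule.smul_mem _ c h
        | mem s hs =>
          obtain ⟨p, rfl⟩ := hs
          induction ht using Submodule.span_induction with
          | zero => rw [lie_zero]; exact Submodule.zero_mem _
          | add t t' _ _ h h' => rw [lie_add]; exact Submodule.add_mem _ h h'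
          | smul c t _ h => rw [lie_smul]; exact Submodule.smul_mem _ c h
          | mem t ht =>
            obtain ⟨q, rfl⟩ := ht
            simp only [tmul_lie_tmul]
            exact Submodule.neg_mem _ (Submodule.subset_span ⟨(_, _), rfl⟩) }
  let g : FreeLieAlgebra F (L × K) →ₗ⁅F⁆ S :=
    FreeLieAlgebra.lift F fun p => ⟨tmul A p.1 p.2, Submodule.subset_span ⟨p, rfl⟩⟩
  have hg : S.incl.comp g = mk A := FreeLieAlgebra.hom_ext fun p => by
    rw [LieHom.comp_apply, FreeLieAlgebra.lift_of_apply]; rfl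
  refine eq_top_iff.2 fun t _ => ?_
  obtain ⟨a, rfl⟩ := mk_surjective A t
  rw [← hg]
  exact (g a).2

theorem linearMap_ext {V : Type*} [AddCommGroup V] [Module F V] {f g : LieTensor A →ₗ[F] V}
    (h : ∀ l k, f (tmul A l k) = g (tmul A l k)) : f = g :=
  LinearMap.ext_on (span_tmul_eq_top A) (by rintro _ ⟨p, rfl⟩; exact h p.1 p.2)

/-- A bilinear map which respects the defining relations, for the zero bracket on its target,
descends to a linear map on `L ⊗ K`. -/
theorem exists_linearMap_of_bilin {V : Type*} [AddCommGroup V] [Module F V]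
    (f : L →ₗ[F] K →ₗ[F] V)
    (h_left : ∀ l l' k, f ⁅l, l'⁆ k = f l (A.actL l' k) - f l' (A.actL l k))
    (h_right : ∀ l k k', f l ⁅k, k'⁆ = f (A.actK k' l) k - f (A.actK k l) k')
    (h_lie : ∀ l l' k k', f (A.actK k l) (A.actL l' k') = 0) :
    ∃ g : LieTensor A →ₗ[F] V, (∀ l k, g (tmul A l k) = f l k) ∧
      ∀ s t : LieTensor A, g ⁅s, t⁆ = 0 := by
  let : LieRing V :=
    { ‹AddCommGroup V› with
      bracket := fun _ _ => 0
      add_lie := fun _ _ _ => (add_zero (0 : V)).symm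
      lie_add := fun _ _ _ => (add_zero (0 : V)).symm
      lie_self := fun _ => rfl
      leibniz_lie := fun _ _ _ => (add_zero (0 : V)).symm }
  let : LieAlgebra F V :=
    { ‹Module F V› with
      lie_smul := fun c _ _ => (smul_zero c).symm }
  have lie_eq (v w : V) : ⁅v, w⁆ = 0 := rfl
  let g : LieTensor A →ₗ⁅F⁆ V :=
    desc (FreeLieAlgebra.lift F fun p : L × K => f p.1 p.2) (by
      intro a ha
      cases ha with
      | smul_left c l k => simp
      | smul_right c l k => simp
      | add_left l l' k => simp
      | add_right l k k' => simp
      | lie_left l l' k =>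
        simp only [map_sub, FreeLieAlgebra.lift_of_apply]
        exact sub_eq_zero.2 (h_left l l' k)
      | lie_right l k k' =>
        simp only [map_sub, FreeLieAlgebra.lift_of_apply]
        exact sub_eq_zero.2 (h_right l k k')
      | lie_lie l l' k k' =>
        simp only [map_sub, map_neg, LieHom.map_lie, FreeLieAlgebra.lift_of_apply, h_lie, lie_eq,
          neg_zero, sub_zero])
  refine ⟨(g : LieTensor A →ₗ[F] V), fun l k => ?_, fun s t => ?_⟩
  · exact (desc_tmul _ _ l k).trans (FreeLieAlgebra.lift_of_apply _ _)
  · exact (g.map_lie s t).trans (lie_eq _ _)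

variable {ι : Type*} [Fintype ι]

/-- The linear map `(lᵢ) ↦ ∑ lᵢ ⊗ sᵢ` attached to a finite family `s` in `K`. -/
def sumTmul (s : ι → K) : (ι → L) →ₗ[F] LieTensor A :=
  ∑ i, (tmulBilin A).flip (s i) ∘ₗ LinearMap.proj i

theorem sumTmul_apply (s : ι → K) (l : ι → L) : sumTmul A s l = ∑ i, tmul A (l i) (s i) := by
  simp [sumTmul, tmulBilin_apply]

/-- The relation `l ⊗ [k, k'] = ^{k'}l ⊗ k - ^k l ⊗ k'` shows that the `k` for which
every `l ⊗ k` is of the form `∑ lᵢ ⊗ sᵢ` form a Lie subalgebra of `K`. -/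
theorem sumTmul_surjective {s : ι → K} (hs : LieSubalgebra.lieSpan F K (Set.range s) = ⊤) :
    Function.Surjective (sumTmul A s) := by
  classical
  have key (k : K) (hk : k ∈ LieSubalgebra.lieSpan F K (Set.range s)) :
      ∀ l, tmul A l k ∈ LinearMap.range (sumTmul A s) := by
    induction hk using LieSubalgebra.lieSpan_induction with
    | mem k hk =>
      obtain ⟨i, rfl⟩ := hk
      intro l
      refine ⟨Pi.single i l, ?_⟩
      rw [sumTmul_apply, Finset.sum_eq_single i, Pi.single_eq_same]
      · intro j _ hj
        rw [Pi.single_eq_of_ne hj, ← tmulBilin_apply, map_zero, LinearMap.zero_apply]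
      · simp
    | zero =>
      intro l
      rw [← tmulBilin_apply, map_zero]
      exact Submodule.zero_mem _
    | add k k' _ _ h h' =>
      intro l
      rw [tmul_add]
      exact Submodule.add_mem _ (h l) (h' l)
    | smul c k _ h =>
      intro l
      rw [smul_tmul_right]
      exact Submodule.smul_mem _ c (h l)
    | lie k k' _ _ h h' =>
      intro l
      rw [tmul_lie]
      exact Submodule.sub_mem _ (h _) (h' _)
  rw [← LinearMap.range_eq_top, eq_top_iff, ← span_tmul_eq_top A, Submodule.span_le]
  rintro _ ⟨p, rfl⟩
  exact key p.2 (hs ▸ LieSubalgebra.mem_top p.2) p.1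

variable [FiniteDimensional F L]

theorem finiteDimensional_of_lieSpan {s : ι → K}
    (hs : LieSubalgebra.lieSpan F K (Set.range s) = ⊤) : FiniteDimensional F (LieTensor A) :=
  Module.Finite.of_surjective _ (sumTmul_surjective A hs)

theorem finrank_le_of_lieSpan {s : ι → K}
    (hs : LieSubalgebra.lieSpan F K (Set.range s) = ⊤) :
    finrank F (LieTensor A) ≤ Fintype.card ι * finrank F L := by
  have h := LinearMap.finrank_le_finrank_of_surjective (sumTmul_surjective A hs)
  rwa [finrank_pi_fintype, Finset.sum_const, smul_eq_mul, Finset.card_univ] at h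

end LieTensor

/-! ### Nilpotent Lie algebras and their derived ideal -/

section Nilpotent

variable {F : Type u} {L : Type v} [Field F] [LieRing L] [LieAlgebra F L]

theorem lie_mem_derived (a b : L) :
    ⁅a, b⁆ ∈ (⁅(⊤ : LieIdeal F L), (⊤ : LieIdeal F L)⁆ : LieIdeal F L) :=
  LieSubmodule.lie_mem_lie (LieSubmodule.mem_top a) (LieSubmodule.mem_top b)

/-- A subalgebra of a nilpotent Lie algebra which supplements the derived ideal is everything:
inductively, it supplements every term of the lower central series. -/
theorem LieSubalgebra.eq_top_of_sup_derived_eq_top [LieRing.IsNilpotent L] (S : LieSubalgebra F L)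
    (hS : ∀ a : L, ∃ s ∈ S,
      a - s ∈ (⁅(⊤ : LieIdeal F L), (⊤ : LieIdeal F L)⁆ : LieIdeal F L)) : S = ⊤ := by
  have key (k : ℕ) : ∀ a : L, ∃ s ∈ S, a - s ∈ LieModule.lowerCentralSeries F L L k := by
    induction k with
    | zero => exact fun a => ⟨0, S.zero_mem, by simp⟩
    | succ k ih =>
      have derived (d : L) (hd : d ∈ (⁅(⊤ : LieIdeal F L), (⊤ : LieIdeal F L)⁆ : LieIdeal F L)) :
          ∃ s ∈ S, d - s ∈ LieModule.lowerCentralSeries F L L (k + 1) := by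
        rw [← LieSubmodule.mem_toSubmodule, LieSubmodule.lieIdeal_oper_eq_linear_span'] at hd
        induction hd using Submodule.span_induction with
        | zero => exact ⟨0, S.zero_mem, by simp⟩
        | add d d' _ _ h h' =>
          obtain ⟨s, hs, h⟩ := h
          obtain ⟨s', hs', h'⟩ := h'
          refine ⟨s + s', S.add_mem hs hs', ?_⟩
          rw [add_sub_add_comm]
          exact add_mem h h'
        | smul c d _ h =>
          obtain ⟨s, hs, h⟩ := h
          refine ⟨c • s, S.smul_mem c hs, ?_⟩
          rw [← smul_sub]
          exact SMulMemClass.smul_mem c h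
        | mem d hd =>
          obtain ⟨a, -, b, -, rfl⟩ := hd
          obtain ⟨s, hs, h⟩ := ih a
          obtain ⟨s', hs', h'⟩ := ih b
          refine ⟨⁅s, s'⁆, S.lie_mem hs hs', ?_⟩
          -- Modulo `[L, γ]`, for `γ` the current term of the series, the bracket depends only on
          -- the classes of its arguments modulo `γ`.
          have e : ⁅a, b⁆ - ⁅s, s'⁆ = ⁅a, b - s'⁆ - ⁅s', a - s⁆ := by
            rw [lie_sub, lie_sub, ← lie_skew s' a, ← lie_skew s' s]; abel
          rw [e, LieModule.lowerCentralSeries_succ]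
          exact sub_mem (LieSubmodule.lie_mem_lie (LieSubmodule.mem_top _) h')
            (LieSubmodule.lie_mem_lie (LieSubmodule.mem_top _) h)
      intro a
      obtain ⟨s, hs, h⟩ := hS a
      obtain ⟨s', hs', h'⟩ := derived _ h
      refine ⟨s + s', S.add_mem hs hs', ?_⟩
      rwa [← sub_sub]
  obtain ⟨k, hk⟩ := LieModule.IsNilpotent.nilpotent F L L
  refine eq_top_iff.2 fun a _ => ?_
  obtain ⟨s, hs, h⟩ := key k a
  rw [hk, LieSubmodule.mem_bot, sub_eq_zero] at h
  rwa [h]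

variable (F L) in
/-- A nilpotent Lie algebra is generated by `dim L / L²` elements. -/
theorem exists_lieSpan_eq_top [FiniteDimensional F L] [LieRing.IsNilpotent L] :
    ∃ s : Fin (finrank F L -
        finrank F (⁅(⊤ : LieIdeal F L), (⊤ : LieIdeal F L)⁆ : LieIdeal F L)) → L,
      LieSubalgebra.lieSpan F L (Set.range s) = ⊤ := by
  let D : Submodule F L := (⁅(⊤ : LieIdeal F L), (⊤ : LieIdeal F L)⁆ : LieIdeal F L).toSubmodule
  have hD : finrank F (L ⧸ D) = finrank F L -
      finrank F (⁅(⊤ : LieIdeal F L), (⊤ : LieIdeal F L)⁆ : LieIdeal F L) :=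
    D.finrank_quotient
  let b := finBasisOfFinrankEq F (L ⧸ D) hD
  choose s hs using fun i => D.mkQ_surjective (b i)
  refine ⟨s, LieSubalgebra.eq_top_of_sup_derived_eq_top _ fun a => ?_⟩
  refine ⟨∑ i, b.repr (D.mkQ a) i • s i, ?_, ?_⟩
  · exact sum_mem fun i _ =>
      SMulMemClass.smul_mem _ (LieSubalgebra.subset_lieSpan (Set.mem_range_self i))
  · change _ ∈ D
    refine (Submodule.Quotient.mk_eq_zero D).1 ?_
    change D.mkQ _ = 0
    rw [map_sub, map_sum]
    simp only [map_smul, hs]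
    rw [b.sum_repr, sub_self]

/-- If the derived ideal of a nilpotent Lie algebra is a line, then it is central: otherwise
`[L, L²] = L²`, and the lower central series is constant from `L²` on. -/
theorem lie_lie_eq_zero_of_finrank_derived_eq_one [LieRing.IsNilpotent L]
    (h : finrank F (⁅(⊤ : LieIdeal F L), (⊤ : LieIdeal F L)⁆ : LieIdeal F L) = 1) (a b c : L) :
    ⁅a, ⁅b, c⁆⁆ = 0 := by
  set D : LieIdeal F L := ⁅(⊤ : LieIdeal F L), (⊤ : LieIdeal F L)⁆ with hD
  have hfin : FiniteDimensional F D := FiniteDimensional.of_finrank_eq_succ h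
  by_contra hne
  have hle : ⁅(⊤ : LieIdeal F L), D⁆ ≤ D := LieSubmodule.lie_le_right _ _
  have hmem : ⁅a, ⁅b, c⁆⁆ ∈ ⁅(⊤ : LieIdeal F L), D⁆ :=
    LieSubmodule.lie_mem_lie (LieSubmodule.mem_top _) (lie_mem_derived b c)
  have heq : ⁅(⊤ : LieIdeal F L), D⁆ = D := by
    refine le_antisymm hle fun d hd => ?_
    obtain ⟨r, hr⟩ := (finrank_eq_one_iff_of_nonzero' (⟨⁅a, ⁅b, c⁆⁆, hle hmem⟩ : D)
      (fun h0 => hne (congrArg Subtype.val h0))).1 h ⟨d, hd⟩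
    have hr' : r • ⁅a, ⁅b, c⁆⁆ = d := congrArg Subtype.val hr
    rw [← hr']
    exact SMulMemClass.smul_mem r hmem
  have hconst (k : ℕ) : D ≤ LieModule.lowerCentralSeries F L L k := by
    induction k with
    | zero => exact le_top
    | succ k ih =>
      rw [LieModule.lowerCentralSeries_succ, ← heq]
      exact LieSubmodule.mono_lie_right ⊤ ih
  obtain ⟨k, hk⟩ := LieModule.IsNilpotent.nilpotent F L L
  have hz := hconst k (hle hmem)
  rw [hk, LieSubmodule.mem_bot] at hz
  exact hne hz

/-- Two vectors `a`, `b` whose bracket is nonzero and central span a copy of `H(1)` together with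
their bracket. -/
theorem exists_injective_heisenberg {a b : L} (hab : ⁅a, b⁆ ≠ 0) (hz : ∀ u : L, ⁅u, ⁅a, b⁆⁆ = 0) :
    ∃ f : HeisenbergLie F 1 →ₗ⁅F⁆ L, Function.Injective f := by
  have hz' (u : L) : ⁅⁅a, b⁆, u⁆ = 0 := by rw [← lie_skew, hz, neg_zero]
  have hba : ⁅b, a⁆ = -⁅a, b⁆ := (lie_skew b a).symm
  let f : HeisenbergLie F 1 →ₗ⁅F⁆ L :=
    { toFun := fun h => h.x 0 • a + h.y 0 • b + h.z • ⁅a, b⁆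
      map_add' := fun h h' => by
        simp only [HeisenbergLie.add_def, Pi.add_apply, add_smul]; abel
      map_smul' := fun c h => by
        simp only [HeisenbergLie.smul_def, Pi.smul_apply, smul_eq_mul, mul_smul, smul_add,
          RingHom.id_apply]
      map_lie' := by
        intro h h'
        simp only [HeisenbergLie.lie_def, Finset.univ_unique, Fin.default_eq_zero,
          Finset.sum_singleton, Pi.zero_apply, zero_smul, zero_add, add_lie, lie_add, smul_lie,
          lie_smul, lie_self, hz, hz', hba, smul_zero, smul_neg, add_zero]
        module }
  refine ⟨f, (injective_iff_map_eq_zero f).2 fun h hh => ?_⟩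
  have hf : h.x 0 • a + h.y 0 • b + h.z • ⁅a, b⁆ = 0 := hh
  have hx : h.x 0 = 0 := by
    have := congrArg (⁅·, b⁆) hf
    simp only [add_lie, smul_lie, lie_self, hz', smul_zero, add_zero, zero_lie] at this
    exact (smul_eq_zero.1 this).resolve_right hab
  have hy : h.y 0 = 0 := by
    have := congrArg (⁅a, ·⁆) hf
    simp only [lie_add, lie_smul, lie_self, hz, smul_zero, add_zero, lie_zero, zero_add] at this
    exact (smul_eq_zero.1 this).resolve_right hab
  rw [hx, hy, zero_smul, zero_smul, zero_add, zero_add] at hf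
  have hc : h.z = 0 := (smul_eq_zero.1 hf).resolve_right hab
  ext i
  · rw [Fin.fin_one_eq_zero i, hx]; rfl
  · rw [Fin.fin_one_eq_zero i, hy]; rfl
  · exact hc

end Nilpotent

/-! ### The dimension of the Heisenberg algebras -/

namespace HeisenbergLie

variable (F : Type u) [Field F]

/-- The coordinates of `H(m)`. -/
def toProdLinear (m : ℕ) : HeisenbergLie F m ≃ₗ[F] (Fin m → F) × (Fin m → F) × F :=
  { toProd with
    map_add' := fun _ _ => rfl
    map_smul' := fun _ _ => rfl }

instance (m : ℕ) : FiniteDimensional F (HeisenbergLie F m) :=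
  Module.Finite.equiv (toProdLinear F m).symm

theorem finrank_eq (m : ℕ) : finrank F (HeisenbergLie F m) = 2 * m + 1 := by
  rw [(toProdLinear F m).finrank_eq, finrank_prod, finrank_prod, finrank_fin_fun, finrank_self]
  ring

end HeisenbergLie

/-! ### The tensor square when the derived ideal is a line -/

namespace LieTensorSquare

open LieTensor

variable {F : Type u} {L : Type v} [Field F] [LieRing L] [LieAlgebra F L]

variable (F) in
theorem smul_tm (c : F) (a b : L) : tm F (c • a) b = c • tm F a b := smul_tmul_left _ c a b

variable (F) in
theorem tm_smul (c : F) (a b : L) : tm F a (c • b) = c • tm F a b := smul_tmul_right _ c a b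

/-- By the relation `[a, b] ⊗ u = a ⊗ [b, u] - b ⊗ [a, u]`; when `L²` is spanned by `[a, b]`,
the right-hand side is a combination of `a ⊗ [a, b]` and `b ⊗ [a, b]`. -/
theorem tm_lie_mem_span {a b : L} (hspan : ∀ u v : L, ∃ c : F, ⁅u, v⁆ = c • ⁅a, b⁆) (u : L) :
    tm F ⁅a, b⁆ u ∈ Submodule.span F {tm F a ⁅a, b⁆, tm F b ⁅a, b⁆} := by
  obtain ⟨c, hc⟩ := hspan b u
  obtain ⟨d, hd⟩ := hspan a u
  rw [lie_tm, hc, hd, tm_smul, tm_smul]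
  exact sub_mem (Submodule.smul_mem _ _ (Submodule.subset_span (by simp)))
    (Submodule.smul_mem _ _ (Submodule.subset_span (by simp)))

/-- When `L²` is a line and `sᵢ` are three or more generators of `L`, the elements `[a, b] ⊗ sᵢ`
lie in a plane, so that the map `(lᵢ) ↦ ∑ lᵢ ⊗ sᵢ` onto `L ⊗ L` has a kernel. -/
theorem finrank_lt_of_derived_line [FiniteDimensional F L] {d : ℕ} (hd : 3 ≤ d) {s : Fin d → L}
    (hs : LieSubalgebra.lieSpan F L (Set.range s) = ⊤) {a b : L} (hab : ⁅a, b⁆ ≠ 0)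
    (hspan : ∀ u v : L, ∃ c : F, ⁅u, v⁆ = c • ⁅a, b⁆) :
    finrank F (LieTensorSquare F L) < d * finrank F L := by
  classical
  let P : Submodule F (LieTensorSquare F L) :=
    Submodule.span F {tm F a ⁅a, b⁆, tm F b ⁅a, b⁆}
  have hP : finrank F P ≤ 2 := by
    have h := finrank_span_finset_le_card (R := F)
      ({tm F a ⁅a, b⁆, tm F b ⁅a, b⁆} : Finset (LieTensorSquare F L))
    rw [Finset.coe_insert, Finset.coe_singleton] at h
    exact h.trans Finset.card_le_two
  have : FiniteDimensional F P := FiniteDimensional.span_of_finite F (by simp)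
  let e : (Fin d → F) →ₗ[F] P := LinearMap.codRestrict P
    (Fintype.linearCombination F fun i => tm F ⁅a, b⁆ (s i)) fun c => by
      rw [Fintype.linearCombination_apply]
      exact sum_mem fun i _ => Submodule.smul_mem _ _ (tm_lie_mem_span hspan _)
  have hker : LinearMap.ker e ≠ ⊥ := LinearMap.ker_ne_bot_of_finrank_lt (by
    rw [finrank_fin_fun]; omega)
  obtain ⟨c, hc, hc0⟩ := Submodule.exists_mem_ne_zero_of_ne_bot hker
  have hce : ∑ i, c i • tm F ⁅a, b⁆ (s i) = 0 := by
    have := congrArg Subtype.val (LinearMap.mem_ker.1 hc)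
    simpa [e, Fintype.linearCombination_apply] using this
  -- A vanishing combination `∑ cᵢ ([a, b] ⊗ sᵢ)` is the image of the family `cᵢ [a, b]`.
  let Φ := sumTmul (selfActions F L) s
  have hΦ : Φ (fun i => c i • ⁅a, b⁆) = 0 := by
    rw [← hce, sumTmul_apply]
    exact Finset.sum_congr rfl fun i _ => smul_tm F _ _ _
  have hpos : 0 < finrank F (LinearMap.ker Φ) := by
    rw [Nat.pos_iff_ne_zero, Ne, Submodule.finrank_eq_zero]
    intro hbot
    have h0 : (fun i => c i • ⁅a, b⁆) = 0 :=
      (Submodule.mem_bot F).1 (hbot ▸ LinearMap.mem_ker.2 hΦ)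
    exact hc0 (funext fun i => (smul_eq_zero.1 (congrFun h0 i)).resolve_right hab)
  have hrank := LinearMap.finrank_range_add_finrank_ker Φ
  rw [LinearMap.range_eq_top.2 (sumTmul_surjective _ hs), finrank_top, finrank_pi_fintype,
    Finset.sum_const, smul_eq_mul, Finset.card_univ, Fintype.card_fin] at hrank
  change finrank F (LieTensorSquare F L) + _ = _ at hrank
  omega

end LieTensorSquare

/-! ### The triple tensor product of `H(1)` -/

section Heisenberg

open LieTensor LieTensorSquare

variable {F : Type u} {L : Type v} [Field F] [LieRing L] [LieAlgebra F L]

/-- Coordinates on `L ⊗ L` for a Lie algebra `L` with coordinates `α, β, γ` as in `H(1)`: the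
coefficients of `x ⊗ x`, `x ⊗ y`, `y ⊗ x`, `y ⊗ y`, `x ⊗ z = -z ⊗ x` and `y ⊗ z = -z ⊗ y`. -/
theorem exists_coordinates_tensorSquare {α β γ : L →ₗ[F] F} (hα : ∀ u v : L, α ⁅u, v⁆ = 0)
    (hβ : ∀ u v : L, β ⁅u, v⁆ = 0) (hγ : ∀ u v : L, γ ⁅u, v⁆ = α u * β v - β u * α v) :
    ∃ φ : LieTensorSquare F L →ₗ[F] (Fin 6 → F),
      (∀ a b, φ (tm F a b) = ![α a * α b, α a * β b, β a * α b, β a * β b,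
        α a * γ b - γ a * α b, β a * γ b - γ a * β b]) ∧
      ∀ s t : LieTensorSquare F L, φ ⁅s, t⁆ = 0 := by
  let f : L →ₗ[F] L →ₗ[F] (Fin 6 → F) := LinearMap.mk₂ F
    (fun a b => ![α a * α b, α a * β b, β a * α b, β a * β b,
      α a * γ b - γ a * α b, β a * γ b - γ a * β b])
    (fun a a' b => by
      simp only [map_add, Matrix.cons_add_cons, Matrix.empty_add_empty]; ring_nf)
    (fun c a b => by
      simp only [map_smul, smul_eq_mul, Matrix.smul_cons, Matrix.smul_empty]; ring_nf)
    (fun a b b' => by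
      simp only [map_add, Matrix.cons_add_cons, Matrix.empty_add_empty]; ring_nf)
    (fun c a b => by
      simp only [map_smul, smul_eq_mul, Matrix.smul_cons, Matrix.smul_empty]; ring_nf)
  have hf (a b : L) : f a b = ![α a * α b, α a * β b, β a * α b, β a * β b,
    α a * γ b - γ a * α b, β a * γ b - γ a * β b] := rfl
  refine exists_linearMap_of_bilin (selfActions F L) f (fun a a' b => ?_) (fun a b b' => ?_)
    (fun a a' b b' => ?_)
  · simp only [hf, actL_apply, hα, hβ, hγ, Matrix.cons_sub_cons, Matrix.empty_sub_empty]
    ring_nf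
  · simp only [hf, actK_apply, hα, hβ, hγ, Matrix.cons_sub_cons, Matrix.empty_sub_empty]
    ring_nf
  · simp [hf, actL_apply, actK_apply, hα, hβ]

/-- The lower bound for `H(1)`: in `⊗³ L` the elements `t ⊗ x` and `t ⊗ y`, with `t` in a basis of
the 6-dimensional space `L ⊗ L`, are linearly independent. The coordinates of `t ⊗ l` are read off
from `t ⊗ z = ^y t ⊗ x - ^x t ⊗ y`. -/
theorem twelve_le_finrank_lieTensorTriple {α β γ : L →ₗ[F] F} (hα : ∀ u v : L, α ⁅u, v⁆ = 0)
    (hβ : ∀ u v : L, β ⁅u, v⁆ = 0) (hγ : ∀ u v : L, γ ⁅u, v⁆ = α u * β v - β u * α v)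
    {x y z : L} (hx : α x = 1 ∧ β x = 0 ∧ γ x = 0) (hy : α y = 0 ∧ β y = 1 ∧ γ y = 0)
    (hz : α z = 0 ∧ β z = 0 ∧ γ z = 1) [FiniteDimensional F (LieTensorTriple F L)] :
    12 ≤ finrank F (LieTensorTriple F L) := by
  obtain ⟨φ, hφ, hφ_lie⟩ := exists_coordinates_tensorSquare hα hβ hγ
  -- Every `u` acts by `x ⊗ y ↦ u ⊗ z` and `y ⊗ x ↦ -u ⊗ z`, and kills the other basis elements.
  have haction (u : L) (t : LieTensorSquare F L) :
      φ (action F u t) = (φ t 1 - φ t 2) • ![0, 0, 0, 0, α u, β u] := by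
    let g : LieTensorSquare F L →ₗ[F] (Fin 6 → F) :=
      (LinearMap.proj (R := F) (φ := fun _ : Fin 6 => F) 1 ∘ₗ φ -
        LinearMap.proj (R := F) (φ := fun _ : Fin 6 => F) 2 ∘ₗ φ).smulRight
          ![0, 0, 0, 0, α u, β u]
    have h : φ ∘ₗ (action F u : LieTensorSquare F L →ₗ[F] LieTensorSquare F L) = g :=
      linearMap_ext _ fun a b => by
        change φ (action F u (tm F a b)) =
          (φ (tm F a b) 1 - φ (tm F a b) 2) • ![0, 0, 0, 0, α u, β u]
        rw [action_tm, map_add, hφ, hφ, hφ]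
        ext i
        fin_cases i <;> simp [hα, hβ, hγ] <;> ring
    exact LinearMap.congr_fun h t
  have hcomm (t : LieTensorSquare F L) :
      α (commutatorHom F t) = 0 ∧ β (commutatorHom F t) = 0 := by
    have h1 : α ∘ₗ ((commutatorHom F : LieTensorSquare F L →ₗ⁅F⁆ L) :
        LieTensorSquare F L →ₗ[F] L) = 0 :=
      linearMap_ext _ fun a b => by
        change α (commutatorHom F (tm F a b)) = 0
        rw [commutatorHom_tm, hα]
    have h2 : β ∘ₗ ((commutatorHom F : LieTensorSquare F L →ₗ⁅F⁆ L) :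
        LieTensorSquare F L →ₗ[F] L) = 0 :=
      linearMap_ext _ fun a b => by
        change β (commutatorHom F (tm F a b)) = 0
        rw [commutatorHom_tm, hβ]
    exact ⟨LinearMap.congr_fun h1 t, LinearMap.congr_fun h2 t⟩
  let f : LieTensorSquare F L →ₗ[F] L →ₗ[F] (Fin 6 → F) × (Fin 6 → F) := LinearMap.mk₂ F
    (fun t l => (α l • φ t + γ l • (φ t 1 - φ t 2) • ![0, 0, 0, 0, 0, 1],
      β l • φ t - γ l • (φ t 1 - φ t 2) • ![0, 0, 0, 0, 1, 0]))
    (fun t t' l => by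
      simp only [map_add, Pi.add_apply, Prod.mk_add_mk, Prod.mk.injEq]; constructor <;> module)
    (fun c t l => by
      simp only [map_smul, Pi.smul_apply, smul_eq_mul, Prod.smul_mk, Prod.mk.injEq]
      constructor <;> module)
    (fun t l l' => by
      simp only [map_add, Prod.mk_add_mk, Prod.mk.injEq]; constructor <;> module)
    (fun c t l => by
      simp only [map_smul, smul_eq_mul, Prod.smul_mk, Prod.mk.injEq]; constructor <;> module)
  have hf (t : LieTensorSquare F L) (l : L) : f t l =
      (α l • φ t + γ l • (φ t 1 - φ t 2) • ![0, 0, 0, 0, 0, 1],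
        β l • φ t - γ l • (φ t 1 - φ t 2) • ![0, 0, 0, 0, 1, 0]) := rfl
  -- `L ⊗ L` acts trivially on `L`, because `λ` takes central values.
  have hf_act (s t : LieTensorSquare F L) (l : L) : f s ((tripleActions F L).actL t l) = 0 := by
    have h : (tripleActions F L).actL t l = ⁅commutatorHom F t, l⁆ := lieAd_apply _ _
    rw [h, hf, hα, hβ, hγ, (hcomm t).1, (hcomm t).2]
    simp
  have hact (t : LieTensorSquare F L) (l : L) : (tripleActions F L).actK l t = action F l t := rfl
  obtain ⟨ψ, hψ, -⟩ := exists_linearMap_of_bilin (tripleActions F L) f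
    (fun s t l => by rw [hf_act, hf_act, hf, hφ_lie]; simp)
    (fun t l l' => by
      rw [hact, hact, hf, hf, hf, haction, haction, hα, hβ, hγ]
      ext i <;> fin_cases i <;> simp <;> ring)
    (fun s t l l' => hf_act _ _ _)
  have hφ_surj (p : Fin 6 → F) : ∃ t, φ t = p := by
    refine ⟨p 0 • tm F x x + p 1 • tm F x y + p 2 • tm F y x + p 3 • tm F y y + p 4 • tm F x z +
      p 5 • tm F y z, ?_⟩
    simp only [map_add, map_smul, hφ, hx, hy, hz]
    ext i
    fin_cases i <;> simp
  have hψ_surj : Function.Surjective ψ := by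
    rintro ⟨p, q⟩
    obtain ⟨s, rfl⟩ := hφ_surj p
    obtain ⟨t, rfl⟩ := hφ_surj q
    refine ⟨tmul _ s x + tmul _ t y, ?_⟩
    rw [map_add, hψ, hψ, hf, hf]
    simp [hx, hy]
  have h := LinearMap.finrank_le_finrank_of_surjective hψ_surj
  rwa [finrank_prod, finrank_fin_fun] at h

theorem twelve_le_finrank_of_equiv_heisenberg (e : L ≃ₗ⁅F⁆ HeisenbergLie F 1)
    [FiniteDimensional F (LieTensorTriple F L)] : 12 ≤ finrank F (LieTensorTriple F L) := by
  let c : L →ₗ[F] (Fin 1 → F) × (Fin 1 → F) × F :=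
    (HeisenbergLie.toProdLinear F 1).toLinearMap ∘ₗ (e : L →ₗ[F] HeisenbergLie F 1)
  let α : L →ₗ[F] F := LinearMap.proj 0 ∘ₗ LinearMap.fst F _ _ ∘ₗ c
  let β : L →ₗ[F] F := LinearMap.proj 0 ∘ₗ LinearMap.fst F _ _ ∘ₗ LinearMap.snd F _ _ ∘ₗ c
  let γ : L →ₗ[F] F := LinearMap.snd F _ _ ∘ₗ LinearMap.snd F _ _ ∘ₗ c
  have hα (u : L) : α u = (e u).x 0 := rfl
  have hβ (u : L) : β u = (e u).y 0 := rfl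
  have hγ (u : L) : γ u = (e u).z := rfl
  refine twelve_le_finrank_lieTensorTriple (α := α) (β := β) (γ := γ)
    (x := e.symm ⟨1, 0, 0⟩) (y := e.symm ⟨0, 1, 0⟩) (z := e.symm ⟨0, 0, 1⟩)
    (fun u v => ?_) (fun u v => ?_) (fun u v => ?_) ?_ ?_ ?_
  · rw [hα, LieEquiv.map_lie, HeisenbergLie.lie_def]; rfl
  · rw [hβ, LieEquiv.map_lie, HeisenbergLie.lie_def]; rfl
  · rw [hγ, LieEquiv.map_lie, HeisenbergLie.lie_def]
    simp [hα, hβ]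
  all_goals simp [hα, hβ, hγ, LieEquiv.apply_symm_apply]

end Heisenberg

end

/-! ### The bound and the case of equality -/

theorem mainTheorem1 (F : Type u) (L : Type v) [Field F] [LieRing L] [LieAlgebra F L]
    [FiniteDimensional F L] [LieRing.IsNilpotent L] (hL : ¬ IsLieAbelian L)
    (n m : ℕ) (hn : Module.finrank F L = n)
    (hm : Module.finrank F (⁅(⊤ : LieIdeal F L), (⊤ : LieIdeal F L)⁆ : LieIdeal F L) = m) :
    FiniteDimensional F (LieTensorTriple F L) ∧
    (Module.finrank F (LieTensorTriple F L) : ℤ) ≤ (n : ℤ) * ((n : ℤ) - (m : ℤ)) ^ 2 ∧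
    (m = 1 →
      ((Module.finrank F (LieTensorTriple F L) : ℤ) = (n : ℤ) * ((n : ℤ) - (m : ℤ)) ^ 2 ↔
        Nonempty (L ≃ₗ⁅F⁆ HeisenbergLie F 1))) := by
  obtain ⟨d, hd, s, hs⟩ : ∃ d, n - m = d ∧ ∃ s : Fin d → L,
      LieSubalgebra.lieSpan F L (Set.range s) = ⊤ := by
    subst hn hm
    exact ⟨_, rfl, exists_lieSpan_eq_top F L⟩
  have hmn : m ≤ n := hm ▸ hn ▸
    Submodule.finrank_le (⁅(⊤ : LieIdeal F L), (⊤ : LieIdeal F L)⁆ : LieIdeal F L).toSubmodule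
  have hsub : (n : ℤ) - (m : ℤ) = d := by omega
  have hfin2 : FiniteDimensional F (LieTensorSquare F L) :=
    LieTensor.finiteDimensional_of_lieSpan _ hs
  have hfin3 : FiniteDimensional F (LieTensorTriple F L) :=
    LieTensor.finiteDimensional_of_lieSpan _ hs
  have h2 : finrank F (LieTensorSquare F L) ≤ d * n := by
    have h := LieTensor.finrank_le_of_lieSpan (selfActions F L) hs
    rwa [Fintype.card_fin, hn] at h
  have h3 : finrank F (LieTensorTriple F L) ≤ d * finrank F (LieTensorSquare F L) := by
    have h := LieTensor.finrank_le_of_lieSpan (tripleActions F L) hs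
    rwa [Fintype.card_fin] at h
  have hle : finrank F (LieTensorTriple F L) ≤ n * d ^ 2 :=
    h3.trans ((Nat.mul_le_mul_left d h2).trans_eq (by ring))
  rw [hsub]
  refine ⟨hfin3, by exact_mod_cast hle, fun hm1 => ⟨fun heq => ?_, fun ⟨e⟩ => ?_⟩⟩
  · have heq' : finrank F (LieTensorTriple F L) = n * d ^ 2 := by exact_mod_cast heq
    obtain ⟨a, b, hab⟩ : ∃ a b : L, ⁅a, b⁆ ≠ 0 := by
      by_contra! h
      exact hL ⟨h⟩
    rw [hm1] at hm
    obtain ⟨f, hf⟩ := exists_injective_heisenberg (F := F) hab fun u =>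
      lie_lie_eq_zero_of_finrank_derived_eq_one hm u a b
    have hH : finrank F (HeisenbergLie F 1) = 3 := HeisenbergLie.finrank_eq F 1
    have hspan (u v : L) : ∃ c : F, ⁅u, v⁆ = c • ⁅a, b⁆ := by
      obtain ⟨c, hc⟩ := (finrank_eq_one_iff_of_nonzero' (⟨⁅a, b⁆, lie_mem_derived (F := F) a b⟩ :
        (⁅(⊤ : LieIdeal F L), (⊤ : LieIdeal F L)⁆ : LieIdeal F L))
        (fun h0 => hab (congrArg Subtype.val h0))).1 hm ⟨⁅u, v⁆, lie_mem_derived (F := F) u v⟩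
      exact ⟨c, (congrArg Subtype.val hc).symm⟩
    -- The embedding of `H(1)` gives `3 ≤ n`, and equality in the bound forces `n - 1 ≤ 2`.
    have hn3 : 3 ≤ n := by
      rw [← hH, ← hn]
      exact LinearMap.finrank_le_finrank_of_injective (f := (f : HeisenbergLie F 1 →ₗ[F] L)) hf
    have hd2 : ¬ 3 ≤ d := fun hd3 => by
      have hlt := LieTensorSquare.finrank_lt_of_derived_line hd3 hs hab hspan
      rw [hn] at hlt
      have := Nat.mul_lt_mul_of_pos_left hlt (show 0 < d by omega)
      have e : d * (d * n) = n * d ^ 2 := by ring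
      omega
    have hdim : finrank F (HeisenbergLie F 1) = finrank F L := by omega
    have hsurj : Function.Surjective f :=
      (LinearMap.injective_iff_surjective_of_finrank_eq_finrank
        (f := (f : HeisenbergLie F 1 →ₗ[F] L)) hdim).1 hf
    exact ⟨(LieEquiv.ofBijective f ⟨hf, hsurj⟩).symm⟩
  · have hn3 : n = 3 := by
      rw [← hn, e.toLinearEquiv.finrank_eq, HeisenbergLie.finrank_eq]
    have hd2 : d = 2 := by omega
    have h12 := twelve_le_finrank_of_equiv_heisenberg e
    rw [hn3, hd2] at hle ⊢
    exact_mod_cast le_antisymm hle h12
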